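/- Floating-point arithmetic with machine precision $u$ follows the standard model: the computed value of each elementary operation $+,-,\times,/,\sqrt{\ }$ is the exact result times $1+\delta$ for some $|\delta|\le u$; sums are evaluated in any order. Let $\gamma_m(u)=\frac{mu}{1-mu}$, let $\|\cdot\|$ be the spectral norm and $\kappa_2(M)=\|M^{-1}\|\,\|M\|$. Let $A=\begin{pmatrix}A_{11}&A_{12}\\A_{12}^T&A_{22}\end{pmatrix}\in\mathbb R^{2n\times 2n}$ be symmetric positive definite (not necessarily symplectic) with $n\times n$ blocks, and let $S=A_{22}-A_{12}^TA_{11}^{-1}A_{12}$. Algorithm $W_1$ computes the Cholesky factor $L_{11}$ of $A_{11}=L_{11}L_{11}^T$, solves $L_{11}L_{21}^T=A_{12}$ and $L_{11}X=I$ by forward substitution, and returns $L_1=\begin{pmatrix}L_{11}&0\\L_{21}&L_{22}\end{pmatrix}$ with $L_{22}=X^T$. Suppose that Algorithm $W_1$, applied to $A$ in floating-point arithmetic, runs to completion (all computed Cholesky pivots are positive) and produces $\tilde L_1=\begin{pmatrix}\tilde L_{11}&0\\\tilde L_{21}&\tilde L_{22}\end{pmatrix}$. Put $\tilde A_{11}=\tilde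 L_{11}\tilde L_{11}^T$, $\tilde A_{12}=\tilde L_{11}\tilde L_{21}^T$, assume that $\tilde A=\begin{pmatrix}\tilde A_{11}&\tilde A_{12}\\\tilde A_{12}^T&A_{22}\end{pmatrix}$ is positive definite, and let $\tilde S=A_{22}-\tilde A_{12}^T\tilde A_{11}^{-1}\tilde A_{12}$. Then, as $u\to0$, \[ \|\tilde A_{11}^{-1}-A_{11}^{-1}\|\le n\gamma_{n+1}(u)\,\kappa_2(A_{11})\,\|A_{11}^{-1}\|+O(u^2), \] \[ \|\tilde S-S\|\le 3n\gamma_{n+1}(u)\,\kappa_2(A_{11})\,\|A\|+O(u^2), \] \[ \|\tilde A_{11}^{-1}-\tilde S\|\le\|A_{11}^{-1}-S\|+n\gamma_{n+1}(u)\,\kappa_2(A_{11})\bigl(\|A_{11}^{-1}\|+3\|A\|\bigr)+O(u^2), \] \[ \|A-\tilde L_1\tilde L_1^T\|\le\|A_{11}^{-1}-S\|+2n\gamma_{n+1}(u)\|A\|+3n\gamma_{n+1}(u)\,\kappa_2(A_{11})\bigl(\|A\|+\|A_{11}^{-1}\|\bigr)+O(u^2). \] Here $O(u^2)$ denotes a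 quantity at most $Cu^2$ for all $0<u\le u_0$, where $C$ and $u_0>0$ depend only on $A$ (and $n$), not on the individual rounding errors. -/

import Mathlib

open Matrix
open scoped Matrix.Norms.L2Operator

/-- The 2-norm condition number `κ₂(M) = ‖M⁻¹‖₂ ‖M‖₂`. All matrix norms are spectral norms. -/
noncomputable def kappa2 {n : ℕ} (M : Matrix (Fin n) (Fin n) ℝ) : ℝ := ‖M⁻¹‖ * ‖M‖

/-- `γ_m(u) = m u / (1 - m u)`. -/
noncomputable def gammaErr (m : ℕ) (u : ℝ) : ℝ := m * u / (1 - m * u)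

/-- The Schur complement `A₂₂ - A₁₂ᵀ A₁₁⁻¹ A₁₂` of the leading block of a symmetric block matrix. -/
noncomputable def schurCompl {n : ℕ} (A : Matrix (Fin n ⊕ Fin n) (Fin n ⊕ Fin n) ℝ) :
    Matrix (Fin n) (Fin n) ℝ :=
  A.toBlocks₂₂ - A.toBlocks₁₂ᵀ * A.toBlocks₁₁⁻¹ * A.toBlocks₁₂

/-- Standard model of floating-point arithmetic: `y` is an admissible computed value of one
elementary operation (`+`, `-`, `*`, `/`, `√`) with exact result `x`, when the
machine precision is `u`: `y = x (1 + δ)` with `|δ| ≤ u`. -/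
def FlRound (u x y : ℝ) : Prop := ∃ δ : ℝ, |δ| ≤ u ∧ y = x * (1 + δ)

/-- `FlSum u f s y`: `y` is a computed value of `∑ i ∈ s, f i`, where the terms are added two at a
time in some order (with some bracketing), each addition being rounded. -/
inductive FlSum {ι : Type} [DecidableEq ι] (u : ℝ) (f : ι → ℝ) : Finset ι → ℝ → Prop
  | single (i : ι) : FlSum u f {i} (f i)
  | add {s t : Finset ι} {x y z : ℝ} (hst : Disjoint s t) (hx : FlSum u f s x)
      (hy : FlSum u f t y) (hz : FlRound u (x + y) z) : FlSum u f (s ∪ t) z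

/-- `FlSubDot u c K a b y`: `y` is a computed value of `c - ∑ k ∈ K, a k * b k`: the products are
rounded, and `c` and the negated products are then added in some order. -/
def FlSubDot {n : ℕ} (u c : ℝ) (K : Finset (Fin n)) (a b : Fin n → ℝ) (y : ℝ) : Prop :=
  ∃ p : Fin n → ℝ, (∀ k ∈ K, FlRound u (a k * b k) (p k)) ∧
    FlSum u (fun o : Option (Fin n) => o.elim c (fun k => -p k)) (Finset.insertNone K) y

/-- `L` is computed from `M` by a Cholesky factorization `M = L Lᵀ` that runs to
completion in floating-point arithmetic, i.e. every computed pivot `s` is positive. -/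
structure FlCholesky {n : ℕ} (u : ℝ) (M L : Matrix (Fin n) (Fin n) ℝ) : Prop where
  upper : ∀ i j, i < j → L i j = 0
  diag : ∀ j, ∃ s, FlSubDot u (M j j) (Finset.Iio j) (L j) (L j) s ∧ 0 < s ∧
    FlRound u (√s) (L j j)
  lower : ∀ i j, j < i → ∃ s, FlSubDot u (M i j) (Finset.Iio j) (L i) (L j) s ∧
    FlRound u (s / L j j) (L i j)

/-- `X` is computed by forward substitution, in floating-point arithmetic, from the
system `L X = Y` with `L` lower triangular. -/
structure FlForwardSubst {n : ℕ} (u : ℝ) (L Y X : Matrix (Fin n) (Fin n) ℝ) : Prop where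
  diag_ne_zero : ∀ i, L i i ≠ 0
  entry : ∀ i j, ∃ s, FlSubDot u (Y i j) (Finset.Iio i) (L i) (fun k => X k j) s ∧
    FlRound u (s / L i i) (X i j)

/-- Algorithm `W₁` applied to `A` runs to completion in floating-point arithmetic with
machine precision `u` and produces the block lower triangular matrix `L`:
`A₁₁ = L₁₁ L₁₁ᵀ` (Cholesky), `L₁₁ L₂₁ᵀ = A₁₂` and `L₁₁ X = I` (forward substitution), `L₂₂ = Xᵀ`. -/
structure FlAlgorithmW1 {n : ℕ} (u : ℝ) (A L : Matrix (Fin n ⊕ Fin n) (Fin n ⊕ Fin n) ℝ) :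
    Prop where
  cholesky : FlCholesky u A.toBlocks₁₁ L.toBlocks₁₁
  block21 : FlForwardSubst u L.toBlocks₁₁ A.toBlocks₁₂ L.toBlocks₂₁ᵀ
  block22 : FlForwardSubst u L.toBlocks₁₁ 1 L.toBlocks₂₂ᵀ
  block12 : L.toBlocks₁₂ = 0

/-- The perturbed matrix `Ã` with blocks `Ã₁₁ = L₁₁ L₁₁ᵀ`, `Ã₁₂ = L₁₁ L₂₁ᵀ`, `Ã₂₁ = Ã₁₂ᵀ` and
`Ã₂₂ = A₂₂`, formed in exact arithmetic from the computed factor `L`. -/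
def tildeMatrix {n : ℕ} (A L : Matrix (Fin n ⊕ Fin n) (Fin n ⊕ Fin n) ℝ) :
    Matrix (Fin n ⊕ Fin n) (Fin n ⊕ Fin n) ℝ :=
  fromBlocks (L.toBlocks₁₁ * L.toBlocks₁₁ᵀ) (L.toBlocks₁₁ * L.toBlocks₂₁ᵀ)
    (L.toBlocks₁₁ * L.toBlocks₂₁ᵀ)ᵀ A.toBlocks₂₂

/-! Every rounding is moved into a residual. Writing each computed entry as an exact identity with
weights near 1 gives residuals of `A₁₁ - L₁₁L₁₁ᵀ`, `A₁₂ - L₁₁L₂₁ᵀ` and `I - L₁₁X` bounded entrywise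
by `γ_{n+1} |L||R|` (`FlCholesky.abs_sub_le`, `FlForwardSubst.abs_sub_le`). Passing through
Frobenius norms costs a factor `n`, so each residual has relative size `ε = nγ_{n+1}`. Positive
definiteness of `Ã` gives `L₂₁L₂₁ᵀ ≤ A₂₂`, which bounds `L₂₁`.

The rest is deterministic (`block_cholesky_perturbation`). For small `ε`, `‖L₁₁‖²` and `‖L₁₁⁻¹‖²`
equal at most `‖A₁₁‖` and `‖A₁₁⁻¹‖` up to `O(ε)`, uniformly in the errors. An exact identity for the
change of `A₁₂ᵀA₁₁⁻¹A₁₂` has one term linear in the first residual and two in the second, each at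
most `εκ₂(A₁₁)‖A₂₂‖` to first order: hence the 3. Finally, the (2,2) block of `A - L₁L₁ᵀ` is `(S̃ -
Ã₁₁⁻¹) + (Ã₁₁⁻¹ - XᵀX)`, whose second summand is at most `2εκ₂(A₁₁)‖A₁₁⁻¹‖` to first order. -/

/-! ### Calculus of accumulated rounding factors. -/

/-- `t` is a product of at most `k` rounding factors `1 + δ`, `|δ| ≤ u`, or their inverses, up to
enclosure: `(1 - u)^k ≤ t ≤ (1 - u)^(-k)`. -/
def RoundingFactor (u : ℝ) (k : ℕ) (t : ℝ) : Prop :=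
  (1 - u) ^ k ≤ t ∧ t ≤ ((1 - u) ^ k)⁻¹

namespace RoundingFactor

variable {u : ℝ} {k l : ℕ} {s t : ℝ}

theorem pos (hu1 : u < 1) (h : RoundingFactor u k t) : 0 < t :=
  lt_of_lt_of_le (pow_pos (by linarith) k) h.1

theorem one (hu : 0 ≤ u) (hu1 : u < 1) (k : ℕ) : RoundingFactor u k 1 := by
  have h : (1 - u) ^ k ≤ 1 := pow_le_one₀ (by linarith) (by linarith)
  exact ⟨h, (one_le_inv₀ (pow_pos (by linarith) k)).2 h⟩

theorem mono (hu : 0 ≤ u) (hu1 : u < 1) (hkl : k ≤ l) (h : RoundingFactor u k t) :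
    RoundingFactor u l t := by
  have h1 : (1 - u) ^ l ≤ (1 - u) ^ k :=
    pow_le_pow_of_le_one (by linarith) (by linarith) hkl
  exact ⟨h1.trans h.1, h.2.trans (inv_anti₀ (pow_pos (by linarith) l) h1)⟩

theorem mul (hu1 : u < 1) (hs : RoundingFactor u k s) (ht : RoundingFactor u l t) :
    RoundingFactor u (k + l) (s * t) := by
  have hk : 0 < (1 - u) ^ k := pow_pos (by linarith) k
  have hl : 0 < (1 - u) ^ l := pow_pos (by linarith) l
  refine ⟨?_, ?_⟩
  · rw [pow_add]
    exact mul_le_mul hs.1 ht.1 hl.le (hs.pos hu1).le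
  · rw [pow_add, mul_inv]
    exact mul_le_mul hs.2 ht.2 (ht.pos hu1).le (inv_nonneg.2 hk.le)

theorem inv (hu1 : u < 1) (h : RoundingFactor u k t) : RoundingFactor u k t⁻¹ := by
  have hk : 0 < (1 - u) ^ k := pow_pos (by linarith) k
  refine ⟨?_, inv_anti₀ hk h.1⟩
  have := inv_anti₀ (h.pos hu1) h.2
  rwa [inv_inv] at this

theorem one_add (hu : 0 ≤ u) (hu1 : u < 1) {δ : ℝ} (h : |δ| ≤ u) :
    RoundingFactor u 1 (1 + δ) := by
  obtain ⟨h1, h2⟩ := abs_le.1 h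
  refine ⟨by rw [pow_one]; linarith, ?_⟩
  rw [pow_one, le_inv_comm₀ (by linarith) (by linarith), inv_eq_one_div,
    le_div_iff₀ (by linarith)]
  nlinarith

/-- Bernoulli's inequality gives `(1 - u)^k ≥ 1 - ku`, which settles the upper side. The lower side
is no worse because `x + x⁻¹ ≥ 2`. -/
theorem abs_sub_one_le (hu1 : u < 1) (hk : k * u < 1)
    (h : RoundingFactor u k t) : |t - 1| ≤ gammaErr k u := by
  have hb : 1 - k * u ≤ (1 - u) ^ k := by
    have := one_add_mul_le_pow (a := -u) (by linarith) k
    rw [← sub_eq_add_neg] at this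
    linarith
  have hpos : 0 < 1 - k * u := by linarith
  have h1 : t ≤ (1 - k * u)⁻¹ := h.2.trans (inv_anti₀ hpos hb)
  have hg : gammaErr k u = (1 - k * u)⁻¹ - 1 := by
    unfold gammaErr
    field_simp
    ring
  rw [abs_le, hg]
  refine ⟨?_, by linarith⟩
  have h2 := hb.trans h.1
  have h3 : 2 ≤ (1 - k * u) + (1 - k * u)⁻¹ := by
    have h4 : (1 - k * u) * (1 - k * u)⁻¹ = 1 := mul_inv_cancel₀ hpos.ne'
    have h5 : 0 < (1 - k * u)⁻¹ := inv_pos.2 hpos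
    nlinarith [sq_nonneg ((1 - k * u) - (1 - k * u)⁻¹)]
  linarith

end RoundingFactor

/-! ### Entrywise backward errors of sums, triangular solves and Cholesky factors. -/

theorem FlSum.nonempty {ι : Type} [DecidableEq ι] {u : ℝ} {f : ι → ℝ} {s : Finset ι} {y : ℝ}
    (h : FlSum u f s y) : s.Nonempty := by
  induction h with
  | single i => exact Finset.singleton_nonempty i
  | add _ _ _ _ ih _ => exact ih.mono Finset.subset_union_left

/-- A floating-point sum is an exact sum of perturbed terms; the perturbations of any two terms
differ by few rounding factors, since they share those of their common ancestors. -/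
theorem FlSum.exists_factors {ι : Type} [DecidableEq ι] {u : ℝ} (hu : 0 ≤ u) (hu1 : u < 1)
    {f : ι → ℝ} {s : Finset ι} {y : ℝ} (h : FlSum u f s y) :
    ∃ w : ι → ℝ, y = ∑ i ∈ s, w i * f i ∧
      (∀ i ∈ s, RoundingFactor u (s.card - 1) (w i)) ∧
      ∀ i ∈ s, ∀ j ∈ s, RoundingFactor u (s.card - 2) (w i / w j) := by
  induction h with
  | single i =>
    refine ⟨fun _ => 1, by simp, fun _ _ => .one hu hu1 _, fun _ _ _ _ => ?_⟩
    rw [div_one]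
    exact .one hu hu1 _
  | @add s t x y z hst hx hy hz ihx ihy =>
    obtain ⟨v, rfl, hv1, hv2⟩ := ihx
    obtain ⟨w, rfl, hw1, hw2⟩ := ihy
    obtain ⟨δ, hδ, rfl⟩ := hz
    have hδ' := RoundingFactor.one_add hu hu1 hδ
    have hδ0 := hδ'.pos hu1
    have hs := hx.nonempty.card_pos
    have ht := hy.nonempty.card_pos
    have hc : (s ∪ t).card = s.card + t.card := Finset.card_union_of_disjoint hst
    have hnt : ∀ i ∈ t, i ∉ s := fun i hi his => Finset.disjoint_left.1 hst his hi
    refine ⟨fun i => (if i ∈ s then v i else w i) * (1 + δ), ?_, ?_, ?_⟩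
    · rw [Finset.sum_union hst, add_mul, Finset.sum_mul, Finset.sum_mul]
      congr 1
      · refine Finset.sum_congr rfl fun i hi => ?_
        simp only [if_pos hi]
        ring
      · refine Finset.sum_congr rfl fun i hi => ?_
        simp only [if_neg (hnt i hi)]
        ring
    · intro i hi
      rcases Finset.mem_union.1 hi with hi | hi
      · simp only [if_pos hi]
        exact ((hv1 i hi).mul hu1 hδ').mono hu hu1 (by omega)
      · simp only [if_neg (hnt i hi)]
        exact ((hw1 i hi).mul hu1 hδ').mono hu hu1 (by omega)
    · intro i hi j hj
      -- The last rounding is common to all terms and cancels in ratios. Across the two halves,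
      -- `(|s| - 1) + (|t| - 1) = |s ∪ t| - 2`.
      simp only [mul_div_mul_right _ _ hδ0.ne']
      rcases Finset.mem_union.1 hi with hi | hi <;> rcases Finset.mem_union.1 hj with hj | hj
      · rw [if_pos hi, if_pos hj]
        exact (hv2 i hi j hj).mono hu hu1 (by omega)
      · rw [if_pos hi, if_neg (hnt j hj), div_eq_mul_inv]
        exact ((hv1 i hi).mul hu1 ((hw1 j hj).inv hu1)).mono hu hu1 (by omega)
      · rw [if_neg (hnt i hi), if_pos hj, div_eq_mul_inv]
        exact ((hw1 i hi).mul hu1 ((hv1 j hj).inv hu1)).mono hu hu1 (by omega)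
      · rw [if_neg (hnt i hi), if_neg (hnt j hj)]
        exact (hw2 i hi j hj).mono hu hu1 (by omega)

/-- Dividing by the weight of `c` leaves `c` unperturbed. There are `|K| + 1` summands, so a ratio
of weights carries `|K| - 1` factors, and the rounded product adds one. Bounding the two weights
separately would double the count. -/
theorem FlSubDot.exists_factors {n : ℕ} {u : ℝ} (hu : 0 ≤ u) (hu1 : u < 1) {c : ℝ}
    {K : Finset (Fin n)} {a b : Fin n → ℝ} {y : ℝ} (h : FlSubDot u c K a b y) :
    ∃ (t : ℝ) (w : Fin n → ℝ), RoundingFactor u K.card t ∧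
      (∀ k ∈ K, RoundingFactor u K.card (w k)) ∧ c = y * t + ∑ k ∈ K, w k * (a k * b k) := by
  obtain ⟨p, hp, hy⟩ := h
  obtain ⟨w, rfl, hw1, hw2⟩ := hy.exists_factors hu hu1
  rw [Finset.card_insertNone] at hw1 hw2
  have hnone : none ∈ Finset.insertNone K := Finset.none_mem_insertNone
  have h0 := hw1 none hnone
  have hpos := h0.pos hu1
  choose! δ hδ hpδ using hp
  refine ⟨(w none)⁻¹, fun k => w (some k) / w none * (1 + δ k), h0.inv hu1, ?_, ?_⟩
  · intro k hk
    have hc : 0 < K.card := Finset.card_pos.2 ⟨k, hk⟩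
    exact ((hw2 (some k) (Finset.some_mem_insertNone.2 hk) none hnone).mul hu1
      (.one_add hu hu1 (hδ k hk))).mono hu hu1 (by omega)
  · rw [Finset.sum_insertNone, add_mul, Finset.sum_mul, add_assoc, ← Finset.sum_add_distrib]
    rw [Finset.sum_eq_zero fun k hk => ?_]
    · simp only [Option.elim]
      field_simp
      simp
    · simp only [Option.elim, hpδ k hk]
      field_simp
      ring

theorem abs_sub_sum_le_of_roundingFactor {n m : ℕ} {u : ℝ} (hu1 : u < 1)
    (hm : m * u < 1) {c x t : ℝ} {K : Finset (Fin n)} {w p : Fin n → ℝ}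
    (ht : RoundingFactor u m t) (hw : ∀ k ∈ K, RoundingFactor u m (w k))
    (hc : c = x * t + ∑ k ∈ K, w k * p k) :
    |c - (x + ∑ k ∈ K, p k)| ≤ gammaErr m u * (|x| + ∑ k ∈ K, |p k|) := by
  have : c - (x + ∑ k ∈ K, p k) = (t - 1) * x + ∑ k ∈ K, (w k - 1) * p k := by
    simp only [hc, sub_mul, Finset.sum_sub_distrib, one_mul]
    ring
  rw [this, mul_add, Finset.mul_sum]
  refine (abs_add_le _ _).trans (add_le_add ?_ ?_)
  · rw [abs_mul]
    exact mul_le_mul_of_nonneg_right (ht.abs_sub_one_le hu1 hm) (abs_nonneg _)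
  · refine (Finset.abs_sum_le_sum_abs _ _).trans (Finset.sum_le_sum fun k hk => ?_)
    rw [abs_mul]
    exact mul_le_mul_of_nonneg_right ((hw k hk).abs_sub_one_le hu1 hm) (abs_nonneg _)

theorem sum_eq_add_sum_Iio {n : ℕ} (j : Fin n) (f : Fin n → ℝ) (hf : ∀ k, j < k → f k = 0) :
    ∑ k, f k = f j + ∑ k ∈ Finset.Iio j, f k := by
  rw [← Finset.sum_insert (by simp : j ∉ Finset.Iio j)]
  refine (Finset.sum_subset (Finset.subset_univ _) fun k _ hk => hf k ?_).symm
  simp only [Finset.mem_insert, Finset.mem_Iio, not_or, not_lt] at hk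
  exact lt_of_le_of_ne hk.2 (Ne.symm hk.1)

/-- Row `i` uses at most `i` factors from the sum and one from the division. The index `n + 1` is
generous here and matches the Cholesky bound. -/
theorem FlForwardSubst.abs_sub_le {n : ℕ} {u : ℝ} (hu : 0 ≤ u) (hn : (n + 1 : ℕ) * u < 1)
    {L Y X : Matrix (Fin n) (Fin n) ℝ} (hL : ∀ i j, i < j → L i j = 0)
    (h : FlForwardSubst u L Y X) (i j : Fin n) :
    |Y i j - (L * X) i j| ≤ gammaErr (n + 1) u * ∑ k, |L i k| * |X k j| := by
  have hu1 : u < 1 := by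
    push_cast at hn
    nlinarith [mul_nonneg (Nat.cast_nonneg (α := ℝ) n) hu]
  obtain ⟨s, hs, δ, hδ, hX⟩ := h.entry i j
  obtain ⟨t, w, ht, hw, hc⟩ := hs.exists_factors hu hu1
  rw [Fin.card_Iio] at ht hw
  have hi := i.2
  have hδ' := RoundingFactor.one_add hu hu1 hδ
  have hδ0 := (hδ'.pos hu1).ne'
  have hLi := h.diag_ne_zero i
  have hs' : s = L i i * X i j * (1 + δ)⁻¹ := by
    rw [hX]
    field_simp
  have := abs_sub_sum_le_of_roundingFactor (c := Y i j)
    (p := fun k => L i k * X k j) (x := L i i * X i j) hu1 hn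
    (((hδ'.inv hu1).mul hu1 ht).mono hu hu1 (by omega : 1 + (i : ℕ) ≤ n + 1))
    (fun k hk => (hw k hk).mono hu hu1 (by omega)) (by rw [hc, hs']; ring)
  rw [Matrix.mul_apply, sum_eq_add_sum_Iio i (fun k => L i k * X k j)
    (fun k hk => by rw [hL i k hk, zero_mul]), sum_eq_add_sum_Iio i (fun k => |L i k| * |X k j|)
    (fun k hk => by rw [hL i k hk, abs_zero, zero_mul])]
  simpa only [abs_mul] using this

theorem FlCholesky.abs_sub_le_of_le {n : ℕ} {u : ℝ} (hu : 0 ≤ u) (hn : (n + 1 : ℕ) * u < 1)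
    {M L : Matrix (Fin n) (Fin n) ℝ} (h : FlCholesky u M L) {i j : Fin n} (hij : j ≤ i) :
    |M i j - (L * Lᵀ) i j| ≤ gammaErr (n + 1) u * ∑ k, |L i k| * |Lᵀ k j| := by
  have hu1 : u < 1 := by
    push_cast at hn
    nlinarith [mul_nonneg (Nat.cast_nonneg (α := ℝ) n) hu]
  have hj := j.2
  obtain ⟨sd, hsd, hsd0, δd, hδd, hLd⟩ := h.diag j
  have hδd' := RoundingFactor.one_add hu hu1 hδd
  have hδd0 := (hδd'.pos hu1).ne'
  suffices H : ∃ (t : ℝ) (w : Fin n → ℝ), RoundingFactor u (n + 1) t ∧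
      (∀ k ∈ Finset.Iio j, RoundingFactor u (n + 1) (w k)) ∧
      M i j = L i j * L j j * t + ∑ k ∈ Finset.Iio j, w k * (L i k * L j k) by
    obtain ⟨t, w, ht, hw, hc⟩ := H
    have := abs_sub_sum_le_of_roundingFactor hu1 hn ht hw hc
    simp only [Matrix.mul_apply, Matrix.transpose_apply]
    rw [sum_eq_add_sum_Iio j (fun k => L i k * L j k)
      (fun k hk => by rw [h.upper j k hk, mul_zero]), sum_eq_add_sum_Iio j
      (fun k => |L i k| * |L j k|) (fun k hk => by rw [h.upper j k hk, abs_zero, mul_zero])]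
    simpa only [abs_mul] using this
  rcases hij.eq_or_lt with rfl | hij
  · obtain ⟨t, w, ht, hw, hc⟩ := hsd.exists_factors hu hu1
    rw [Fin.card_Iio] at ht hw
    -- The rounding of the square root enters squared: `j + 2 ≤ n + 1` factors, the case that
    -- dictates the index `n + 1`.
    refine ⟨(1 + δd)⁻¹ * (1 + δd)⁻¹ * t, w,
      (((hδd'.inv hu1).mul hu1 (hδd'.inv hu1)).mul hu1 ht).mono hu hu1 (by omega),
      fun k hk => (hw k hk).mono hu hu1 (by omega), ?_⟩
    have : sd = L j j * L j j * ((1 + δd)⁻¹ * (1 + δd)⁻¹) := by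
      rw [hLd]
      field_simp
      exact (Real.sq_sqrt hsd0.le).symm
    rw [hc]
    nth_rw 1 [this]
    ring
  · obtain ⟨s, hs, δ, hδ, hL⟩ := h.lower i j hij
    obtain ⟨t, w, ht, hw, hc⟩ := hs.exists_factors hu hu1
    rw [Fin.card_Iio] at ht hw
    have hδ' := RoundingFactor.one_add hu hu1 hδ
    have hδ0 := (hδ'.pos hu1).ne'
    refine ⟨(1 + δ)⁻¹ * t, w, ((hδ'.inv hu1).mul hu1 ht).mono hu hu1 (by omega),
      fun k hk => (hw k hk).mono hu hu1 (by omega), ?_⟩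
    have hLjj : L j j ≠ 0 := by
      rw [hLd]
      exact mul_ne_zero (Real.sqrt_pos.2 hsd0).ne' hδd0
    have : s = L i j * L j j * (1 + δ)⁻¹ := by
      rw [hL]
      field_simp
    rw [hc]
    nth_rw 1 [this]
    ring

theorem FlCholesky.abs_sub_le {n : ℕ} {u : ℝ} (hu : 0 ≤ u) (hn : (n + 1 : ℕ) * u < 1)
    {M L : Matrix (Fin n) (Fin n) ℝ} (hM : M.IsSymm) (h : FlCholesky u M L) (i j : Fin n) :
    |M i j - (L * Lᵀ) i j| ≤ gammaErr (n + 1) u * ∑ k, |L i k| * |Lᵀ k j| := by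
  rcases le_total j i with hij | hij
  · exact h.abs_sub_le_of_le hu hn hij
  · have := h.abs_sub_le_of_le hu hn hij
    rw [hM.apply] at this
    simpa only [Matrix.mul_apply, Matrix.transpose_apply, mul_comm] using this

/-! ### Spectral norm: Frobenius comparison, blocks, semidefinite order. -/

theorem le_of_sq_le_sq_of_nonneg {a b : ℝ} (h : a ^ 2 ≤ b ^ 2) (hb : 0 ≤ b) : a ≤ b :=
  (le_abs_self a).trans (abs_le_of_sq_le_sq h hb)

section SpectralNorm

set_option linter.unusedSectionVars false

variable {m n l k : Type*} [Fintype m] [Fintype n] [Fintype l] [Fintype k] [DecidableEq m]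
  [DecidableEq n] [DecidableEq l] [DecidableEq k]

theorem Matrix.l2_opNorm_transpose (M : Matrix m n ℝ) : ‖Mᵀ‖ = ‖M‖ := by
  rw [← conjTranspose_eq_transpose_of_trivial, l2_opNorm_conjTranspose]

theorem Matrix.l2_opNorm_transpose_mul_self (M : Matrix m n ℝ) : ‖Mᵀ * M‖ = ‖M‖ ^ 2 := by
  rw [← conjTranspose_eq_transpose_of_trivial, l2_opNorm_conjTranspose_mul_self, sq]

theorem Matrix.l2_opNorm_mul_self_transpose (M : Matrix m n ℝ) : ‖M * Mᵀ‖ = ‖M‖ ^ 2 := by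
  simpa [l2_opNorm_transpose] using l2_opNorm_transpose_mul_self Mᵀ

theorem Matrix.sum_mulVec_sq_le (M : Matrix m n ℝ) (x : n → ℝ) :
    ∑ i, (M *ᵥ x) i ^ 2 ≤ ‖M‖ ^ 2 * ∑ j, x j ^ 2 := by
  have h := pow_le_pow_left₀ (norm_nonneg _) (l2_opNorm_mulVec M (WithLp.toLp 2 x)) 2
  rw [mul_pow, EuclideanSpace.norm_sq_eq, EuclideanSpace.norm_sq_eq] at h
  simpa using h

theorem Matrix.l2_opNorm_le_of_sum_sq_le {M : Matrix m n ℝ} {c : ℝ} (hc : 0 ≤ c)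
    (h : ∀ x : n → ℝ, ∑ i, (M *ᵥ x) i ^ 2 ≤ c ^ 2 * ∑ j, x j ^ 2) : ‖M‖ ≤ c := by
  rw [l2_opNorm_def]
  refine ContinuousLinearMap.opNorm_le_bound _ hc fun x => ?_
  refine le_of_sq_le_sq_of_nonneg ?_ (mul_nonneg hc (norm_nonneg _))
  rw [mul_pow, EuclideanSpace.norm_sq_eq, EuclideanSpace.norm_sq_eq]
  simpa using h x.ofLp

theorem Matrix.l2_opNorm_sq_le_sum_sq (M : Matrix m n ℝ) : ‖M‖ ^ 2 ≤ ∑ i, ∑ j, M i j ^ 2 := by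
  have h0 : 0 ≤ ∑ i, ∑ j, M i j ^ 2 :=
    Finset.sum_nonneg fun i _ => Finset.sum_nonneg fun j _ => sq_nonneg _
  have : ‖M‖ ≤ √(∑ i, ∑ j, M i j ^ 2) := by
    refine l2_opNorm_le_of_sum_sq_le (Real.sqrt_nonneg _) fun x => ?_
    rw [Real.sq_sqrt h0, Finset.sum_mul]
    exact Finset.sum_le_sum fun i _ => Finset.sum_mul_sq_le_sq_mul_sq _ _ _
  exact (Real.le_sqrt (norm_nonneg _) h0).1 this

/-- Each column is the image of a unit vector. -/
theorem Matrix.sum_sq_le_card_mul (M : Matrix m n ℝ) :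
    ∑ i, ∑ j, M i j ^ 2 ≤ Fintype.card n * ‖M‖ ^ 2 := by
  rw [Finset.sum_comm, ← nsmul_eq_mul, ← Finset.card_univ, ← Finset.sum_const]
  refine Finset.sum_le_sum fun j _ => ?_
  simpa [Pi.single_apply] using sum_mulVec_sq_le M (Pi.single j 1)

/-- A matrix dominated entrywise by `g |L| |R|` has spectral norm at most `g ‖L‖_F ‖R‖_F`. -/
theorem Matrix.l2_opNorm_le_of_abs_le {E : Matrix m n ℝ} {L : Matrix m l ℝ} {R : Matrix l n ℝ}
    {g p q : ℝ} (hg : 0 ≤ g) (hp : 0 ≤ p) (hq : 0 ≤ q) (hL : ∑ i, ∑ k, L i k ^ 2 ≤ p ^ 2)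
    (hR : ∑ k, ∑ j, R k j ^ 2 ≤ q ^ 2)
    (h : ∀ i j, |E i j| ≤ g * ∑ k, |L i k| * |R k j|) : ‖E‖ ≤ g * (p * q) := by
  refine le_of_sq_le_sq_of_nonneg ((l2_opNorm_sq_le_sum_sq E).trans ?_) (by positivity)
  calc ∑ i, ∑ j, E i j ^ 2
      ≤ ∑ i, ∑ j, g ^ 2 * ((∑ k, L i k ^ 2) * ∑ k, R k j ^ 2) := by
        refine Finset.sum_le_sum fun i _ => Finset.sum_le_sum fun j _ => ?_
        rw [← sq_abs]
        refine (pow_le_pow_left₀ (abs_nonneg _) (h i j) 2).trans ?_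
        rw [mul_pow]
        refine mul_le_mul_of_nonneg_left ?_ (sq_nonneg g)
        simpa using Finset.sum_mul_sq_le_sq_mul_sq Finset.univ (fun k => |L i k|)
          (fun k => |R k j|)
    _ = g ^ 2 * ((∑ i, ∑ k, L i k ^ 2) * ∑ k, ∑ j, R k j ^ 2) := by
        rw [Finset.sum_comm (f := fun k j => R k j ^ 2), Finset.sum_mul_sum, Finset.mul_sum]
        simp only [Finset.mul_sum]
    _ ≤ g ^ 2 * (p ^ 2 * q ^ 2) := by gcongr
    _ = (g * (p * q)) ^ 2 := by ring

theorem Matrix.l2_opNorm_toBlocks₁₁_le (M : Matrix (m ⊕ l) (n ⊕ k) ℝ) : ‖M.toBlocks₁₁‖ ≤ ‖M‖ := by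
  refine l2_opNorm_le_of_sum_sq_le (norm_nonneg _) fun x => ?_
  have h := sum_mulVec_sq_le M (Sum.elim x 0)
  simp only [Fintype.sum_sum_type, Sum.elim_inl, Sum.elim_inr, Pi.zero_apply, ne_eq,
    OfNat.ofNat_ne_zero, not_false_eq_true, zero_pow, Finset.sum_const_zero, add_zero] at h
  refine le_trans ?_ (le_trans (le_add_of_nonneg_right (Finset.sum_nonneg fun i _ => sq_nonneg _)) h)
  refine le_of_eq (Finset.sum_congr rfl fun i _ => ?_)
  simp [mulVec, dotProduct, toBlocks₁₁]

theorem Matrix.l2_opNorm_toBlocks₂₂_le (M : Matrix (m ⊕ l) (n ⊕ k) ℝ) : ‖M.toBlocks₂₂‖ ≤ ‖M‖ := by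
  refine l2_opNorm_le_of_sum_sq_le (norm_nonneg _) fun x => ?_
  have h := sum_mulVec_sq_le M (Sum.elim 0 x)
  simp only [Fintype.sum_sum_type, Sum.elim_inl, Sum.elim_inr, Pi.zero_apply, ne_eq,
    OfNat.ofNat_ne_zero, not_false_eq_true, zero_pow, Finset.sum_const_zero, zero_add] at h
  refine le_trans ?_ (le_trans (le_add_of_nonneg_left (Finset.sum_nonneg fun i _ => sq_nonneg _)) h)
  refine le_of_eq (Finset.sum_congr rfl fun i _ => ?_)
  simp [mulVec, dotProduct, toBlocks₂₂]

theorem Matrix.l2_opNorm_fromBlocks_diagonal_le (P : Matrix m n ℝ) (Q : Matrix l k ℝ) :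
    ‖fromBlocks P 0 0 Q‖ ≤ ‖P‖ + ‖Q‖ := by
  refine l2_opNorm_le_of_sum_sq_le (by positivity) fun x => ?_
  have h1 := sum_mulVec_sq_le P (x ∘ Sum.inl)
  have h2 := sum_mulVec_sq_le Q (x ∘ Sum.inr)
  have h3 : 0 ≤ ∑ i, x (Sum.inl i) ^ 2 := Finset.sum_nonneg fun i _ => sq_nonneg _
  have h4 : 0 ≤ ∑ i, x (Sum.inr i) ^ 2 := Finset.sum_nonneg fun i _ => sq_nonneg _
  simp only [fromBlocks_mulVec, Fintype.sum_sum_type, Sum.elim_inl, Sum.elim_inr, zero_mulVec,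
    add_zero, zero_add, Function.comp_apply] at h1 h2 ⊢
  have hP := norm_nonneg P
  have hQ := norm_nonneg Q
  rw [mul_add]
  refine add_le_add (h1.trans ?_) (h2.trans ?_) <;> gcongr <;> linarith

/-- The blocks act on orthogonal halves with orthogonal images, so the norm is a maximum and not a
sum. The off-diagonal residual is thus counted once. -/
theorem Matrix.l2_opNorm_fromBlocks_antidiagonal_le {P : Matrix m n ℝ} {Q : Matrix l k ℝ} {c : ℝ}
    (hP : ‖P‖ ≤ c) (hQ : ‖Q‖ ≤ c) : ‖fromBlocks 0 P Q 0‖ ≤ c := by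
  refine l2_opNorm_le_of_sum_sq_le ((norm_nonneg P).trans hP) fun x => ?_
  have h1 := sum_mulVec_sq_le P (x ∘ Sum.inr)
  have h2 := sum_mulVec_sq_le Q (x ∘ Sum.inl)
  simp only [fromBlocks_mulVec, Fintype.sum_sum_type, Sum.elim_inl, Sum.elim_inr, zero_mulVec,
    add_zero, zero_add, Function.comp_apply] at h1 h2 ⊢
  rw [mul_add, add_comm]
  refine add_le_add (h2.trans ?_) (h1.trans ?_) <;> gcongr

theorem Matrix.dotProduct_mulVec_le (M : Matrix n n ℝ) (x : n → ℝ) :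
    x ⬝ᵥ M *ᵥ x ≤ ‖M‖ * ∑ i, x i ^ 2 := by
  have h0 : 0 ≤ ∑ i, x i ^ 2 := Finset.sum_nonneg fun i _ => sq_nonneg _
  refine le_of_sq_le_sq_of_nonneg ?_ (by positivity)
  calc (x ⬝ᵥ M *ᵥ x) ^ 2 ≤ (∑ i, x i ^ 2) * ∑ i, (M *ᵥ x) i ^ 2 :=
        Finset.sum_mul_sq_le_sq_mul_sq _ _ _
    _ ≤ (∑ i, x i ^ 2) * (‖M‖ ^ 2 * ∑ i, x i ^ 2) := by
        gcongr
        exact sum_mulVec_sq_le M x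
    _ = _ := by ring

/-- `‖Pᵀx‖² = xᵀPPᵀx ≤ xᵀMx ≤ ‖M‖‖x‖²`. -/
theorem Matrix.l2_opNorm_sq_le_of_posSemidef_sub {P : Matrix m n ℝ} {M : Matrix m m ℝ}
    (h : (M - P * Pᵀ).PosSemidef) : ‖P‖ ^ 2 ≤ ‖M‖ := by
  rw [← l2_opNorm_transpose, ← Real.le_sqrt (norm_nonneg _) (norm_nonneg _)]
  refine l2_opNorm_le_of_sum_sq_le (Real.sqrt_nonneg _) fun x => ?_
  rw [Real.sq_sqrt (norm_nonneg _)]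
  refine le_trans ?_ (dotProduct_mulVec_le M x)
  have hx := h.dotProduct_mulVec_nonneg x
  rw [star_trivial, sub_mulVec, dotProduct_sub, ← mulVec_mulVec, dotProduct_mulVec x P,
    ← mulVec_transpose] at hx
  simp only [sq]
  exact sub_nonneg.1 hx

end SpectralNorm

/-! ### Perturbation of inverses and of the Schur complement. -/

section Perturbation

variable {n : Type*} [Fintype n] [DecidableEq n]

theorem Matrix.norm_inv_sub_inv_le {M N : Matrix n n ℝ} (hM : IsUnit M.det) (hN : IsUnit N.det) :
    ‖M⁻¹ - N⁻¹‖ ≤ ‖M⁻¹‖ * ‖M - N‖ * ‖N⁻¹‖ := by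
  have : M⁻¹ - N⁻¹ = -(M⁻¹ * (M - N) * N⁻¹) := by
    rw [mul_sub, sub_mul, nonsing_inv_mul M hM, Matrix.mul_assoc, mul_nonsing_inv N hN]
    simp
  rw [this, norm_neg]
  exact (norm_mul_le _ _).trans (by gcongr; exact norm_mul_le _ _)

/-- Perturbation of `A₁₂ᵀ A₁₁⁻¹ A₁₂` when `A₁₁` and `A₁₂` are replaced by `L Lᵀ` and `L Kᵀ`. -/
theorem Matrix.norm_transpose_mul_inv_mul_sub_le {M N L K : Matrix n n ℝ} (hM : IsUnit M.det)
    (hMs : M.IsSymm) (hL : IsUnit L.det) :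
    ‖Nᵀ * M⁻¹ * N - K * Kᵀ‖ ≤
      (‖L⁻¹‖ * ‖K‖ + ‖M⁻¹ - (L * Lᵀ)⁻¹‖ * (‖L‖ * ‖K‖)) * ‖M - L * Lᵀ‖ * (‖L⁻¹‖ * ‖K‖) +
      2 * (‖N - L * Kᵀ‖ * (‖L⁻¹‖ * ‖K‖ + ‖M⁻¹ - (L * Lᵀ)⁻¹‖ * (‖L‖ * ‖K‖))) +
      ‖N - L * Kᵀ‖ * ‖M⁻¹‖ * ‖N - L * Kᵀ‖ := by
  have hLt : IsUnit Lᵀ.det := by rwa [det_transpose]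
  set E := M - L * Lᵀ with hE
  set F := N - L * Kᵀ with hF
  -- `Z` and `Y` solve the systems with right side `L Kᵀ` and matrices `L Lᵀ` and `M`.
  set Z := Lᵀ⁻¹ * Kᵀ with hZ
  set Y := M⁻¹ * (L * Kᵀ) with hY
  have hMi : M⁻¹ᵀ = M⁻¹ := by rw [transpose_nonsing_inv, hMs.eq]
  -- Cancelling `L` first keeps the main term of order `κ`; bounding `(L Lᵀ)⁻¹` and `L Kᵀ`
  -- separately would give `κ²`. `Y` differs from `Z` by a small correction.
  have hZn : ‖Z‖ ≤ ‖L⁻¹‖ * ‖K‖ := by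
    refine (norm_mul_le _ _).trans (le_of_eq ?_)
    rw [← transpose_nonsing_inv, l2_opNorm_transpose, l2_opNorm_transpose]
  have hYZ : Y = Z + (M⁻¹ - (L * Lᵀ)⁻¹) * (L * Kᵀ) := by
    have : (L * Lᵀ)⁻¹ * (L * Kᵀ) = Z := by
      rw [mul_inv_rev, Matrix.mul_assoc, ← Matrix.mul_assoc L⁻¹, nonsing_inv_mul L hL,
        Matrix.one_mul]
    rw [sub_mul, this]
    abel
  have hYn : ‖Y‖ ≤ ‖L⁻¹‖ * ‖K‖ + ‖M⁻¹ - (L * Lᵀ)⁻¹‖ * (‖L‖ * ‖K‖) := by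
    rw [hYZ]
    refine (norm_add_le _ _).trans (add_le_add hZn ((norm_mul_le _ _).trans ?_))
    gcongr
    refine (norm_mul_le _ _).trans (le_of_eq ?_)
    rw [l2_opNorm_transpose]
  have hYt : Yᵀ = K * Lᵀ * M⁻¹ := by
    rw [hY, transpose_mul, transpose_mul, hMi, transpose_transpose]
  -- With `Y` on the left and `Z` on the right, the effect of `E` is an exact identity without
  -- remainder.
  have hkey : Yᵀ * E * Z = K * Kᵀ - Yᵀ * (L * Kᵀ) := by
    have h1 : Lᵀ * Z = Kᵀ := by
      rw [hZ, ← Matrix.mul_assoc, mul_nonsing_inv _ hLt, Matrix.one_mul]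
    have h2 : Yᵀ * M = K * Lᵀ := by
      rw [hYt, Matrix.mul_assoc, nonsing_inv_mul M hM, Matrix.mul_one]
    rw [hE, mul_sub, sub_mul, h2, Matrix.mul_assoc, h1, Matrix.mul_assoc Yᵀ, Matrix.mul_assoc L, h1]
  have hN : N = L * Kᵀ + F := by rw [hF]; abel
  have hid : Nᵀ * M⁻¹ * N - K * Kᵀ = -(Yᵀ * E * Z) + (Fᵀ * Y + Yᵀ * F) + Fᵀ * M⁻¹ * F := by
    rw [hkey, hN, transpose_add, transpose_mul, transpose_transpose, hYt, hY]
    noncomm_ring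
  rw [hid]
  refine (norm_add_le _ _).trans (add_le_add ((norm_add_le _ _).trans (add_le_add ?_ ?_)) ?_)
  · rw [norm_neg]
    refine (norm_mul_le _ _).trans ?_
    gcongr
    refine (norm_mul_le _ _).trans ?_
    rw [l2_opNorm_transpose]
    gcongr
  · rw [two_mul]
    refine (norm_add_le _ _).trans (add_le_add ?_ ?_)
    · refine (norm_mul_le _ _).trans ?_
      rw [l2_opNorm_transpose]
      gcongr
    · refine (norm_mul_le _ _).trans ?_
      rw [l2_opNorm_transpose, mul_comm]
      gcongr
  · refine (norm_mul_le _ _).trans ?_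
    gcongr
    refine (norm_mul_le _ _).trans ?_
    rw [l2_opNorm_transpose]

theorem Matrix.norm_le_of_approx_inv {L X : Matrix n n ℝ} (hL : IsUnit L.det) :
    ‖X‖ ≤ ‖L⁻¹‖ + ‖L⁻¹‖ * ‖1 - L * X‖ := by
  have : X = L⁻¹ - L⁻¹ * (1 - L * X) := by
    rw [mul_sub, ← Matrix.mul_assoc, nonsing_inv_mul L hL]
    simp
  nth_rw 1 [this]
  exact (norm_sub_le _ _).trans (by gcongr; exact norm_mul_le _ _)

theorem Matrix.norm_inv_sub_transpose_mul_self_le {L X : Matrix n n ℝ} (hL : IsUnit L.det) :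
    ‖(L * Lᵀ)⁻¹ - Xᵀ * X‖ ≤
      2 * (‖L⁻¹‖ ^ 2 * ‖1 - L * X‖) + ‖L⁻¹‖ ^ 2 * ‖1 - L * X‖ ^ 2 := by
  set W := L⁻¹ with hW
  set G := 1 - L * X with hG
  have hX : X = W - W * G := by
    rw [hG, mul_sub, ← Matrix.mul_assoc, nonsing_inv_mul L hL]
    simp
  have hid : (L * Lᵀ)⁻¹ - Xᵀ * X = Wᵀ * (W * G) + (W * G)ᵀ * W - (W * G)ᵀ * (W * G) := by
    rw [mul_inv_rev, ← transpose_nonsing_inv, ← hW, hX, transpose_sub]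
    noncomm_ring
  have hWG : ‖W * G‖ ≤ ‖W‖ * ‖G‖ := norm_mul_le _ _
  rw [hid]
  calc _ ≤ ‖W‖ * (‖W‖ * ‖G‖) + (‖W‖ * ‖G‖) * ‖W‖ + (‖W‖ * ‖G‖) * (‖W‖ * ‖G‖) := by
        refine (norm_sub_le _ _).trans (add_le_add ((norm_add_le _ _).trans (add_le_add ?_ ?_)) ?_)
        all_goals
          refine (norm_mul_le _ _).trans ?_
          rw [l2_opNorm_transpose]
          gcongr
    _ = _ := by ring

end Perturbation

/-! ### Scalar estimates and the first-order perturbation theorem. -/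

/-- First-order bounds on the norms `l` of the computed Cholesky factor and `w` of its inverse. -/
theorem cholesky_norm_bounds {a b ε l w : ℝ} (hb : 0 ≤ b) (hε : 0 ≤ ε)
    (hε1 : ε ≤ 1 / 2) (hε2 : ε * (a * b + (2 * (a * b) + 12 * (a * b) ^ 2)) ≤ 1 / 2)
    (hl : l ^ 2 ≤ a + ε * l ^ 2) (hw : w ^ 2 ≤ b + b * (ε * l ^ 2) * w ^ 2) :
    l ^ 2 ≤ a + 2 * a * ε ∧ w ^ 2 ≤ b + 4 * (a * b) * b * ε ∧
      l ^ 2 * w ^ 2 ≤ a * b + (2 * (a * b) + 12 * (a * b) ^ 2) * ε := by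
  have hl0 := sq_nonneg l
  have hw0 := sq_nonneg w
  -- Absorption gives crude bounds `2a` and `2b`, which are then substituted into the error terms to
  -- get the sharp ones.
  have hl2 : l ^ 2 ≤ 2 * a := by nlinarith
  have ha : 0 ≤ a := by linarith
  have hab : 0 ≤ a * b := by positivity
  have hl3 : l ^ 2 ≤ a + 2 * a * ε := by
    have : ε * l ^ 2 ≤ ε * (2 * a) := by gcongr
    linarith
  have h1 : b * (ε * l ^ 2) ≤ 2 * (a * b) * ε := by
    have : b * (ε * l ^ 2) ≤ b * (ε * (2 * a)) := by gcongr
    linarith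
  have h2 : 2 * (a * b) * ε ≤ 1 / 2 := by nlinarith [mul_nonneg hε hab, mul_nonneg hε (sq_nonneg (a * b))]
  have hw2 : w ^ 2 ≤ 2 * b := by
    have : b * (ε * l ^ 2) * w ^ 2 ≤ 1 / 2 * w ^ 2 := by gcongr; linarith
    linarith
  have hw3 : w ^ 2 ≤ b + 4 * (a * b) * b * ε := by
    have : b * (ε * l ^ 2) * w ^ 2 ≤ 2 * (a * b) * ε * (2 * b) := by gcongr
    linarith
  refine ⟨hl3, hw3, ?_⟩
  calc l ^ 2 * w ^ 2 ≤ (a + 2 * a * ε) * (b + 4 * (a * b) * b * ε) := by gcongr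
    _ = a * b + (2 * (a * b) + 4 * (a * b) ^ 2) * ε + 8 * (a * b) ^ 2 * ε * ε := by ring
    _ ≤ a * b + (2 * (a * b) + 4 * (a * b) ^ 2) * ε + 8 * (a * b) ^ 2 * ε * 1 := by
        gcongr
        linarith
    _ = _ := by ring

/-- Here `a, b, c` stand for `‖M‖, ‖M⁻¹‖, ‖R‖`; `l, w, K` for the norms of `L, L⁻¹, K`; `e, f` for
the residuals of `M, N`; `δ` for the error of the inverse. The leading terms are `εc(lw)²` and
`2εc(lw)`. -/
theorem schur_scalar_bound {a b c d q r ε l w k K e f δ : ℝ} (ha : 0 ≤ a) (hb : 0 ≤ b)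
    (hd : 0 ≤ d) (hε : 0 ≤ ε) (hl : 0 ≤ l) (hw : 0 ≤ w) (hk : 0 ≤ k)
    (hK : 0 ≤ K) (he0 : 0 ≤ e) (hf0 : 0 ≤ f) (hδ0 : 0 ≤ δ) (hkc : k ^ 2 = c) (hKk : K ≤ k)
    (he : e ≤ ε * l ^ 2) (hf : f ≤ ε * (l * k)) (hδ : δ ≤ ε * d) (hl2 : l ^ 2 ≤ 2 * a)
    (hlw1 : 1 ≤ l * w) (hlw : l ^ 2 * w ^ 2 ≤ a * b + r * ε) (hlwq : l ^ 2 * w ^ 2 ≤ q) :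
    (w * K + δ * (l * K)) * e * (w * K) + 2 * (f * (w * K + δ * (l * K))) + f * b * f ≤
      3 * ε * (a * b) * c +
        (3 * r * c + c * (2 * a * q * d + 4 * a * d + 2 * a * b)) * ε ^ 2 := by
  have hc : 0 ≤ c := hkc ▸ sq_nonneg k
  -- As `lw ≥ 1`, the factor `lw` may be replaced by its square, which is `κ + O(ε)`.
  have h1 : l * w ≤ l ^ 2 * w ^ 2 := by nlinarith
  have hq : l * w ≤ q := h1.trans hlwq
  calc _ ≤ (w * k + ε * d * (l * k)) * (ε * l ^ 2) * (w * k) +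
        2 * (ε * (l * k) * (w * k + ε * d * (l * k))) + ε * (l * k) * b * (ε * (l * k)) := by
        gcongr
    _ = ε * c * (l ^ 2 * w ^ 2) + 2 * ε * c * (l * w) +
        ε ^ 2 * (c * (l ^ 2 * (l * w) * d + 2 * l ^ 2 * d + l ^ 2 * b)) := by
        rw [← hkc]
        ring
    _ ≤ ε * c * (a * b + r * ε) + 2 * ε * c * (a * b + r * ε) +
        ε ^ 2 * (c * (2 * a * q * d + 2 * (2 * a) * d + 2 * a * b)) := by
        have := h1.trans hlw
        gcongr
    _ = _ := by ring

/-- Here `x, g` are the norms of `X` and `1 - L X`. The bound on `g` involves `x`, so `x ≤ 2w` is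
obtained by absorption and fed back to give `g ≤ ε(lw)(1 + 2εq)`. -/
theorem approx_inv_scalar_bound {b κ q r β ε l w x g : ℝ} (hb : 0 ≤ b) (_hκ : 0 ≤ κ)
    (hr : 0 ≤ r) (hβ : 0 ≤ β) (hε : 0 ≤ ε) (hε1 : ε ≤ 1) (hl : 0 ≤ l) (hw : 0 ≤ w)
    (hx0 : 0 ≤ x) (hg0 : 0 ≤ g) (hεq : ε * q ≤ 1 / 2) (hw2 : w ^ 2 ≤ b + β * ε)
    (hlw1 : 1 ≤ l * w) (hlw : l ^ 2 * w ^ 2 ≤ κ + r * ε) (hlwq : l ^ 2 * w ^ 2 ≤ q)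
    (hx : x ≤ w + w * g) (hg : g ≤ ε * (l * x)) :
    2 * (w ^ 2 * g) + w ^ 2 * g ^ 2 ≤ 2 * ε * κ * b +
      (2 * (b * r + β * κ + β * r) + 4 * q * ((b + β) * (κ + r)) + 4 * (b + β) * q ^ 2) *
        ε ^ 2 := by
  have h1 : l * w ≤ l ^ 2 * w ^ 2 := by nlinarith
  have hq : l * w ≤ q := h1.trans hlwq
  have hq0 : 0 ≤ q := le_trans (by positivity) hq
  have hx2 : x ≤ 2 * w := by
    have : w * g ≤ x / 2 := calc
      w * g ≤ w * (ε * (l * x)) := by gcongr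
      _ = ε * (l * w) * x := by ring
      _ ≤ ε * q * x := by gcongr
      _ ≤ 1 / 2 * x := by gcongr
      _ = x / 2 := by ring
    linarith
  have hg2 : g ≤ 2 * ε * q := calc
    g ≤ ε * (l * (2 * w)) := hg.trans (by gcongr)
    _ = 2 * ε * (l * w) := by ring
    _ ≤ 2 * ε * q := by gcongr
  have hg3 : g ≤ ε * (l ^ 2 * w ^ 2) * (1 + 2 * ε * q) := calc
    g ≤ ε * (l * (w + w * (2 * ε * q))) := hg.trans (by gcongr; exact hx.trans (by gcongr))
    _ = ε * (l * w) * (1 + 2 * ε * q) := by ring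
    _ ≤ _ := by gcongr
  have hw3 : w ^ 2 ≤ b + β := hw2.trans (by nlinarith)
  have hκ3 : l ^ 2 * w ^ 2 ≤ κ + r := hlw.trans (by nlinarith)
  have hy : w ^ 2 * (l ^ 2 * w ^ 2) ≤ b * κ + (b * r + β * κ + β * r) * ε := calc
    _ ≤ (b + β * ε) * (κ + r * ε) := by gcongr
    _ = b * κ + (b * r + β * κ) * ε + β * r * ε * ε := by ring
    _ ≤ b * κ + (b * r + β * κ) * ε + β * r * ε * 1 := by gcongr
    _ = _ := by ring
  calc 2 * (w ^ 2 * g) + w ^ 2 * g ^ 2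
      ≤ 2 * (w ^ 2 * (ε * (l ^ 2 * w ^ 2) * (1 + 2 * ε * q))) + (b + β) * (2 * ε * q) ^ 2 := by
        gcongr
    _ = 2 * ε * (w ^ 2 * (l ^ 2 * w ^ 2)) + 4 * ε ^ 2 * q * (w ^ 2 * (l ^ 2 * w ^ 2)) +
        4 * (b + β) * q ^ 2 * ε ^ 2 := by ring
    _ ≤ 2 * ε * (b * κ + (b * r + β * κ + β * r) * ε) +
        4 * ε ^ 2 * q * ((b + β) * (κ + r)) + 4 * (b + β) * q ^ 2 * ε ^ 2 := by
        gcongr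
    _ = _ := by ring

/-- First-order perturbation bounds for an approximate block Cholesky factorization with relative
residuals of size `ε`; the second-order constant depends only on the factorized matrix. -/
theorem block_cholesky_perturbation {n : Type*} [Fintype n] [DecidableEq n] [Nonempty n]
    {M N R : Matrix n n ℝ} (hM : IsUnit M.det) (hMs : M.IsSymm) :
    ∃ C ε₀ : ℝ, 0 ≤ C ∧ 0 < ε₀ ∧ ∀ ε : ℝ, 0 ≤ ε → ε ≤ ε₀ → ∀ L K X : Matrix n n ℝ,
      IsUnit L.det → ‖K‖ ^ 2 ≤ ‖R‖ → ‖M - L * Lᵀ‖ ≤ ε * ‖L‖ ^ 2 →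
      ‖N - L * Kᵀ‖ ≤ ε * (‖L‖ * √‖R‖) → ‖1 - L * X‖ ≤ ε * (‖L‖ * ‖X‖) →
      ‖(L * Lᵀ)⁻¹ - M⁻¹‖ ≤ ε * (‖M⁻¹‖ * ‖M‖) * ‖M⁻¹‖ + C * ε ^ 2 ∧
      ‖Nᵀ * M⁻¹ * N - K * Kᵀ‖ ≤ 3 * ε * (‖M⁻¹‖ * ‖M‖) * ‖R‖ + C * ε ^ 2 ∧
      ‖M - L * Lᵀ‖ ≤ ε * ‖M‖ + C * ε ^ 2 ∧
      ‖N - L * Kᵀ‖ ≤ ε * ((‖M‖ + ‖R‖) / 2) + C * ε ^ 2 ∧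
      ‖(L * Lᵀ)⁻¹ - Xᵀ * X‖ ≤ 2 * ε * (‖M⁻¹‖ * ‖M‖) * ‖M⁻¹‖ + C * ε ^ 2 := by
  obtain ⟨a, ha'⟩ : ∃ a, a = ‖M‖ := ⟨_, rfl⟩
  obtain ⟨b, hb'⟩ : ∃ b, b = ‖M⁻¹‖ := ⟨_, rfl⟩
  obtain ⟨c, hc'⟩ : ∃ c, c = ‖R‖ := ⟨_, rfl⟩
  have ha : 0 ≤ a := ha' ▸ norm_nonneg _
  have hb : 0 ≤ b := hb' ▸ norm_nonneg _
  have hc : 0 ≤ c := hc' ▸ norm_nonneg _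
  obtain ⟨r, hr'⟩ : ∃ r, r = 2 * (a * b) + 12 * (a * b) ^ 2 := ⟨_, rfl⟩
  have hr : 0 ≤ r := by rw [hr']; positivity
  obtain ⟨q, hq'⟩ : ∃ q, q = a * b + r := ⟨_, rfl⟩
  have hq : 0 ≤ q := by rw [hq']; positivity
  obtain ⟨β, hβ'⟩ : ∃ β, β = 4 * (a * b) * b := ⟨_, rfl⟩
  have hβ : 0 ≤ β := by rw [hβ']; positivity
  obtain ⟨d, hd'⟩ : ∃ d, d = b * q := ⟨_, rfl⟩
  have hd : 0 ≤ d := by rw [hd']; positivity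
  obtain ⟨C₂, hC₂⟩ : ∃ C₂, C₂ = 3 * r * c + c * (2 * a * q * d + 4 * a * d + 2 * a * b) := ⟨_, rfl⟩
  have hC₂0 : 0 ≤ C₂ := by rw [hC₂]; positivity
  obtain ⟨C₅, hC₅⟩ : ∃ C₅, C₅ = 2 * (b * r + β * (a * b) + β * r) +
    4 * q * ((b + β) * (a * b + r)) + 4 * (b + β) * q ^ 2 := ⟨_, rfl⟩
  have hC₅0 : 0 ≤ C₅ := by rw [hC₅]; positivity
  -- The constant adds the second-order constants of the five bounds. The threshold ensures `εq ≤
  -- 1/2`, where `q` dominates `‖L‖²‖L⁻¹‖²`; `q + 1` avoids division by zero.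
  refine ⟨b * r + C₂ + 2 * a + C₅, min (1 / 2) (1 / (2 * (q + 1))), by positivity,
    by positivity, fun ε hε hεle L K X hL hK hE hF hG => ?_⟩
  have hε1 : ε ≤ 1 / 2 := hεle.trans (min_le_left _ _)
  have hεq : ε * q ≤ 1 / 2 := by
    have := hεle.trans (min_le_right _ _)
    rw [le_div_iff₀ (by positivity)] at this
    nlinarith
  rw [← hc'] at hK hF
  rw [← ha', ← hb', ← hc']
  obtain ⟨l, hl'⟩ : ∃ l, l = ‖L‖ := ⟨_, rfl⟩
  obtain ⟨w, hw'⟩ : ∃ w, w = ‖L⁻¹‖ := ⟨_, rfl⟩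
  have hl : 0 ≤ l := hl' ▸ norm_nonneg _
  have hw : 0 ≤ w := hw' ▸ norm_nonneg _
  have hLL : IsUnit (L * Lᵀ).det := by
    rw [det_mul, det_transpose]
    exact hL.mul hL
  have hn1 : ‖L * Lᵀ‖ = l ^ 2 := by rw [l2_opNorm_mul_self_transpose, hl']
  have hn2 : ‖(L * Lᵀ)⁻¹‖ = w ^ 2 := by
    rw [Matrix.mul_inv_rev, ← transpose_nonsing_inv, l2_opNorm_transpose_mul_self, hw']
  have hlw1 : 1 ≤ l * w := by
    have := norm_mul_le L L⁻¹
    rw [mul_nonsing_inv L hL, CStarRing.norm_one] at this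
    rwa [hl', hw']
  have hD := norm_inv_sub_inv_le hM hLL
  rw [← hl'] at hE hF hG
  rw [hn2, ← hb'] at hD
  have hl2 : l ^ 2 ≤ a + ε * l ^ 2 := by
    have : ‖L * Lᵀ‖ ≤ ‖M‖ + ‖M - L * Lᵀ‖ := by
      have := norm_sub_le M (M - L * Lᵀ)
      rwa [sub_sub_cancel] at this
    rw [hn1, ← ha'] at this
    linarith
  have hD2 : ‖M⁻¹ - (L * Lᵀ)⁻¹‖ ≤ b * (ε * l ^ 2) * w ^ 2 := hD.trans (by gcongr)
  have hw2 : w ^ 2 ≤ b + b * (ε * l ^ 2) * w ^ 2 := by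
    have : ‖(L * Lᵀ)⁻¹‖ ≤ ‖M⁻¹‖ + ‖M⁻¹ - (L * Lᵀ)⁻¹‖ := by
      have := norm_sub_le M⁻¹ (M⁻¹ - (L * Lᵀ)⁻¹)
      rwa [sub_sub_cancel] at this
    rw [hn2, ← hb'] at this
    linarith
  obtain ⟨hla, hwb, hlw⟩ := cholesky_norm_bounds hb hε hε1 (by rw [← hr', ← hq']; exact hεq) hl2 hw2
  rw [← hr'] at hlw
  rw [← hβ'] at hwb
  have hlwq : l ^ 2 * w ^ 2 ≤ q := by
    have : r * ε ≤ r := mul_le_of_le_one_right hr (by linarith)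
    linarith
  have hl2a : l ^ 2 ≤ 2 * a := by
    have : ε * l ^ 2 ≤ 1 / 2 * l ^ 2 := by gcongr
    linarith
  have hD3 : ‖M⁻¹ - (L * Lᵀ)⁻¹‖ ≤ ε * b * (l ^ 2 * w ^ 2) := hD2.trans (le_of_eq (by ring))
  have hε2 : 0 ≤ ε ^ 2 := sq_nonneg ε
  have hsum : ∀ {C' : ℝ}, C' ≤ b * r + C₂ + 2 * a + C₅ → ∀ {y z : ℝ}, y ≤ z + C' * ε ^ 2 →
      y ≤ z + (b * r + C₂ + 2 * a + C₅) * ε ^ 2 := fun h y z hy =>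
    hy.trans (by gcongr)
  have hbr : 0 ≤ b * r := by positivity
  have hk := Real.sqrt_nonneg c
  have hkc : √c ^ 2 = c := Real.sq_sqrt hc
  refine ⟨hsum (C' := b * r) (by linarith) ?_, hsum (C' := C₂) (by linarith) ?_,
    hsum (C' := 2 * a) (by linarith) ?_, hsum (C' := 2 * a) (by linarith) ?_,
    hsum (C' := C₅) (by linarith) ?_⟩
  · rw [norm_sub_rev]
    calc _ ≤ ε * b * (a * b + r * ε) := hD3.trans (by gcongr)
      _ = _ := by ring
  · refine (norm_transpose_mul_inv_mul_sub_le hM hMs hL).trans ?_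
    rw [← hl', ← hw', ← hb', hC₂, mul_comm b a]
    exact schur_scalar_bound ha hb hd hε hl hw hk (norm_nonneg _) (norm_nonneg _) (norm_nonneg _)
      (norm_nonneg _) hkc ((Real.le_sqrt (norm_nonneg _) hc).2 hK) hE hF
      (hD3.trans (by rw [hd', mul_assoc]; gcongr)) hl2a hlw1 hlw hlwq
  · calc _ ≤ ε * (a + 2 * a * ε) := hE.trans (by gcongr)
      _ = _ := by ring
  · have : l * √c ≤ (a + c) / 2 + a * ε := by
      have := two_mul_le_add_sq l √c
      linarith
    calc _ ≤ ε * ((a + c) / 2 + a * ε) := hF.trans (by gcongr)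
      _ = ε * ((a + c) / 2) + a * ε ^ 2 := by ring
      _ ≤ ε * ((a + c) / 2) + 2 * a * ε ^ 2 := by
        gcongr
        linarith
  · refine (norm_inv_sub_transpose_mul_self_le hL).trans ?_
    rw [← hw', hC₅, mul_comm b a]
    have hX := norm_le_of_approx_inv (X := X) hL
    rw [← hw'] at hX
    exact approx_inv_scalar_bound hb (by positivity) hr hβ hε (by linarith) hl hw (norm_nonneg _)
      (norm_nonneg _) hεq hwb hlw1 hlw hlwq hX hG

/-! ### From entrywise residuals to norms. -/

theorem gammaErr_le {m : ℕ} {u : ℝ} (hu : 0 ≤ u) (hm : m * u ≤ 1 / 2) :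
    gammaErr m u ≤ 2 * m * u := by
  unfold gammaErr
  have : 0 ≤ (m : ℝ) * u := by positivity
  rw [div_le_iff₀ (by linarith)]
  nlinarith

theorem gammaErr_nonneg {m : ℕ} {u : ℝ} (hu : 0 ≤ u) (hm : m * u ≤ 1 / 2) :
    0 ≤ gammaErr m u :=
  div_nonneg (by positivity) (by linarith)

/-- Each of the two Frobenius norms costs `√n`: this is the factor `n` of the theorem. -/
theorem norm_le_of_abs_le_gammaErr {n : ℕ} {E L R : Matrix (Fin n) (Fin n) ℝ} {g p : ℝ}
    (hg : 0 ≤ g) (hp : 0 ≤ p) (hR : ∑ k, ∑ j, R k j ^ 2 ≤ n * p ^ 2)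
    (h : ∀ i j, |E i j| ≤ g * ∑ k, |L i k| * |R k j|) : ‖E‖ ≤ n * g * (‖L‖ * p) := by
  have hn : (0 : ℝ) ≤ n := Nat.cast_nonneg n
  have := l2_opNorm_le_of_abs_le (p := √n * ‖L‖) (q := √n * p) hg (by positivity) (by positivity)
    (by rw [mul_pow, Real.sq_sqrt hn]; simpa using sum_sq_le_card_mul L)
    (by rwa [mul_pow, Real.sq_sqrt hn]) h
  refine this.trans (le_of_eq ?_)
  calc _ = (√n * √n) * g * (‖L‖ * p) := by ring
    _ = _ := by rw [Real.mul_self_sqrt hn]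

/-- Diagonal entries of `R - K Kᵀ` are nonnegative, so each row of `K` has squared norm at most
`‖R‖`. -/
theorem sum_sq_le_of_posSemidef_sub {n : ℕ} {K R : Matrix (Fin n) (Fin n) ℝ}
    (h : (R - K * Kᵀ).PosSemidef) : ∑ k, ∑ j, Kᵀ k j ^ 2 ≤ n * √‖R‖ ^ 2 := by
  rw [Real.sq_sqrt (norm_nonneg _), Finset.sum_comm]
  calc ∑ j, ∑ k, Kᵀ k j ^ 2 ≤ ∑ j : Fin n, ‖R‖ := by
        refine Finset.sum_le_sum fun j _ => ?_
        have h1 : 0 ≤ (R - K * Kᵀ) j j := h.diag_nonneg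
        have h2 := dotProduct_mulVec_le R (Pi.single j 1)
        simp only [mulVec_single_one, single_one_dotProduct, Matrix.col_apply] at h2
        simp only [Matrix.sub_apply, Matrix.mul_apply, Matrix.transpose_apply, ← sq] at h1
        simp only [Matrix.transpose_apply]
        simp [Pi.single_apply] at h2
        linarith
    _ = _ := by simp

/-! ### Block structure of `Ã` and of `A - L Lᵀ`. -/

section BlockFactor

variable {n : ℕ} {A L : Matrix (Fin n ⊕ Fin n) (Fin n ⊕ Fin n) ℝ}

theorem isUnit_det_toBlocks₁₁ (hA : A.PosDef) : IsUnit A.toBlocks₁₁.det :=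
  (hA.submatrix (e := Sum.inl) Sum.inl_injective).det_pos.ne'.isUnit

theorem isUnit_det_of_tildeMatrix_posDef (hT : (tildeMatrix A L).PosDef) :
    IsUnit L.toBlocks₁₁.det := by
  have h := isUnit_det_toBlocks₁₁ hT
  rw [tildeMatrix, toBlocks_fromBlocks₁₁, det_mul] at h
  exact isUnit_of_mul_isUnit_left h

theorem schurCompl_tildeMatrix (hL : IsUnit L.toBlocks₁₁.det) :
    schurCompl (tildeMatrix A L) = A.toBlocks₂₂ - L.toBlocks₂₁ * L.toBlocks₂₁ᵀ := by
  have hLt : IsUnit L.toBlocks₁₁ᵀ.det := by rwa [det_transpose]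
  simp only [schurCompl, tildeMatrix, toBlocks_fromBlocks₁₁, toBlocks_fromBlocks₁₂,
    toBlocks_fromBlocks₂₂]
  rw [transpose_mul, transpose_transpose, Matrix.mul_inv_rev, Matrix.mul_assoc,
    Matrix.mul_assoc _ L.toBlocks₁₁⁻¹, ← Matrix.mul_assoc L.toBlocks₁₁⁻¹, nonsing_inv_mul _ hL,
    Matrix.one_mul, Matrix.mul_assoc, ← Matrix.mul_assoc L.toBlocks₁₁ᵀ, mul_nonsing_inv _ hLt,
    Matrix.one_mul]

theorem posSemidef_schurCompl_tildeMatrix (hT : (tildeMatrix A L).PosDef) :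
    (A.toBlocks₂₂ - L.toBlocks₂₁ * L.toBlocks₂₁ᵀ).PosSemidef := by
  rw [← schurCompl_tildeMatrix (isUnit_det_of_tildeMatrix_posDef hT)]
  have h11 : (L.toBlocks₁₁ * L.toBlocks₁₁ᵀ).PosDef :=
    hT.submatrix (e := Sum.inl) Sum.inl_injective
  let := h11.isUnit.invertible
  have h := hT.posSemidef
  rw [tildeMatrix, ← conjTranspose_eq_transpose_of_trivial (L.toBlocks₁₁ * L.toBlocks₂₁ᵀ),
    PosDef.fromBlocks₁₁ _ _ h11] at h
  simpa [schurCompl, tildeMatrix] using h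

theorem sub_mul_transpose_eq_fromBlocks (hA : A.IsSymm) (hL : L.toBlocks₁₂ = 0) :
    A - L * Lᵀ = fromBlocks (A.toBlocks₁₁ - L.toBlocks₁₁ * L.toBlocks₁₁ᵀ)
      (A.toBlocks₁₂ - L.toBlocks₁₁ * L.toBlocks₂₁ᵀ)
      (A.toBlocks₁₂ - L.toBlocks₁₁ * L.toBlocks₂₁ᵀ)ᵀ
      (A.toBlocks₂₂ - L.toBlocks₂₁ * L.toBlocks₂₁ᵀ - L.toBlocks₂₂ * L.toBlocks₂₂ᵀ) := by
  have hA21 : A.toBlocks₂₁ = A.toBlocks₁₂ᵀ := by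
    ext i j
    exact hA.apply _ _
  nth_rw 1 [← fromBlocks_toBlocks A]
  rw [← fromBlocks_toBlocks L, hL, hA21, fromBlocks_transpose, fromBlocks_multiply, sub_eq_add_neg,
    fromBlocks_neg, fromBlocks_add]
  simp only [toBlocks_fromBlocks₁₁, toBlocks_fromBlocks₂₁, toBlocks_fromBlocks₂₂, transpose_zero,
    Matrix.mul_zero, Matrix.zero_mul, add_zero,
    ← sub_eq_add_neg, transpose_sub, transpose_mul, transpose_transpose, sub_sub]

theorem norm_fromBlocks_symm_le (P F Q : Matrix (Fin n) (Fin n) ℝ) :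
    ‖fromBlocks P F Fᵀ Q‖ ≤ ‖P‖ + ‖Q‖ + ‖F‖ := by
  have : fromBlocks P F Fᵀ Q = fromBlocks P 0 0 Q + fromBlocks 0 F Fᵀ 0 := by
    simp [fromBlocks_add]
  rw [this]
  exact (norm_add_le _ _).trans (add_le_add (l2_opNorm_fromBlocks_diagonal_le P Q)
    (l2_opNorm_fromBlocks_antidiagonal_le le_rfl (l2_opNorm_transpose F).le))

end BlockFactor

/-! ### Assembly of the four bounds. -/

theorem mainTheorem2 (n : ℕ) (A : Matrix (Fin n ⊕ Fin n) (Fin n ⊕ Fin n) ℝ) (hA : A.PosDef) :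
    ∃ C u₀ : ℝ, 0 < u₀ ∧ ∀ u : ℝ, 0 < u → u ≤ u₀ →
      ∀ L : Matrix (Fin n ⊕ Fin n) (Fin n ⊕ Fin n) ℝ,
        FlAlgorithmW1 u A L → (tildeMatrix A L).PosDef →
        ‖(tildeMatrix A L).toBlocks₁₁⁻¹ - A.toBlocks₁₁⁻¹‖ ≤
            n * gammaErr (n + 1) u * kappa2 A.toBlocks₁₁ * ‖A.toBlocks₁₁⁻¹‖ + C * u ^ 2 ∧
        ‖schurCompl (tildeMatrix A L) - schurCompl A‖ ≤
            3 * n * gammaErr (n + 1) u * kappa2 A.toBlocks₁₁ * ‖A‖ + C * u ^ 2 ∧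
        ‖(tildeMatrix A L).toBlocks₁₁⁻¹ - schurCompl (tildeMatrix A L)‖ ≤
            ‖A.toBlocks₁₁⁻¹ - schurCompl A‖ +
              n * gammaErr (n + 1) u * kappa2 A.toBlocks₁₁ *
                (‖A.toBlocks₁₁⁻¹‖ + 3 * ‖A‖) + C * u ^ 2 ∧
        ‖A - L * Lᵀ‖ ≤
            ‖A.toBlocks₁₁⁻¹ - schurCompl A‖ + 2 * n * gammaErr (n + 1) u * ‖A‖ +
              3 * n * gammaErr (n + 1) u * kappa2 A.toBlocks₁₁ *
                (‖A‖ + ‖A.toBlocks₁₁⁻¹‖) + C * u ^ 2 := by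
  rcases Nat.eq_zero_or_pos n with rfl | hn
  -- For `n = 0` all norms vanish; the perturbation theorem needs a nonempty index type.
  · refine ⟨0, 1, one_pos, fun u _ _ L _ _ => ?_⟩
    have h1 : ∀ M : Matrix (Fin 0) (Fin 0) ℝ, ‖M‖ = 0 := fun M => by
      rw [Subsingleton.elim M 0, norm_zero]
    have h2 : ∀ M : Matrix (Fin 0 ⊕ Fin 0) (Fin 0 ⊕ Fin 0) ℝ, ‖M‖ = 0 := fun M => by
      rw [Subsingleton.elim M 0, norm_zero]
    simp [h1, h2]
  have : Nonempty (Fin n) := ⟨⟨0, hn⟩⟩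
  have hAs : A.IsSymm := hA.isHermitian
  have hA11s : A.toBlocks₁₁.IsSymm := by
    ext i j
    exact hAs.apply _ _
  obtain ⟨C, ε₀, hC, hε₀, H⟩ := block_cholesky_perturbation (N := A.toBlocks₁₂)
    (R := A.toBlocks₂₂) (isUnit_det_toBlocks₁₁ hA) hA11s
  have hn0 : (0 : ℝ) < n := Nat.cast_pos.2 hn
  obtain ⟨m, hm⟩ : ∃ m : ℝ, m = 2 * n * (n + 1) := ⟨_, rfl⟩
  have hm0 : 0 < m := by rw [hm]; positivity
  -- The last bound adds all five second-order errors, hence the 5, and `nγ_{n+1} ≤ mu`. The two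
  -- thresholds give `(n + 1)u ≤ 1/2` and `nγ_{n+1} ≤ ε₀`.
  refine ⟨5 * C * m ^ 2, min (1 / (2 * (n + 1))) (ε₀ / m), by positivity, ?_⟩
  intro u hu huu L hW hT
  have hu1 : (n + 1 : ℕ) * u ≤ 1 / 2 := by
    have := huu.trans (min_le_left _ _)
    rw [le_div_iff₀ (by positivity)] at this
    push_cast
    linarith
  have hu1' : (n + 1 : ℕ) * u < 1 := by linarith
  have hg0 := gammaErr_nonneg hu.le hu1
  have hgm : n * gammaErr (n + 1) u ≤ m * u := by
    have := gammaErr_le hu.le hu1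
    push_cast at this
    calc _ ≤ n * (2 * (n + 1) * u) := by gcongr
      _ = m * u := by rw [hm]; ring
  have hε : n * gammaErr (n + 1) u ≤ ε₀ := by
    have := huu.trans (min_le_right _ _)
    rw [le_div_iff₀ hm0] at this
    linarith
  have hε2 : C * (n * gammaErr (n + 1) u) ^ 2 ≤ C * m ^ 2 * u ^ 2 := by
    rw [mul_assoc, ← mul_pow]
    gcongr
  have hdet := isUnit_det_of_tildeMatrix_posDef hT
  have hpsd := posSemidef_schurCompl_tildeMatrix hT
  have hup := hW.cholesky.upper
  obtain ⟨b1, b2, b3, b4, b5⟩ := H _ (by positivity) hε L.toBlocks₁₁ L.toBlocks₂₁ L.toBlocks₂₂ᵀ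
    hdet (l2_opNorm_sq_le_of_posSemidef_sub hpsd)
    (by
      have := norm_le_of_abs_le_gammaErr hg0 (norm_nonneg L.toBlocks₁₁)
        (by simpa [l2_opNorm_transpose] using sum_sq_le_card_mul L.toBlocks₁₁ᵀ)
        (fun i j => hW.cholesky.abs_sub_le hu.le hu1' hA11s i j)
      rwa [← sq] at this)
    (norm_le_of_abs_le_gammaErr hg0 (Real.sqrt_nonneg _) (sum_sq_le_of_posSemidef_sub hpsd)
      fun i j => hW.block21.abs_sub_le hu.le hu1' hup i j)
    (norm_le_of_abs_le_gammaErr hg0 (norm_nonneg _)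
      (by simpa using sum_sq_le_card_mul L.toBlocks₂₂ᵀ)
      fun i j => hW.block22.abs_sub_le hu.le hu1' hup i j)
  have hS : schurCompl (tildeMatrix A L) - schurCompl A =
      A.toBlocks₁₂ᵀ * A.toBlocks₁₁⁻¹ * A.toBlocks₁₂ - L.toBlocks₂₁ * L.toBlocks₂₁ᵀ := by
    rw [schurCompl_tildeMatrix hdet, schurCompl]
    abel
  have hT11 : (tildeMatrix A L).toBlocks₁₁ = L.toBlocks₁₁ * L.toBlocks₁₁ᵀ := rfl
  have h11 := l2_opNorm_toBlocks₁₁_le A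
  have h22 := l2_opNorm_toBlocks₂₂_le A
  rw [← hS] at b2
  rw [← hT11] at b1 b5
  have hLL := sub_mul_transpose_eq_fromBlocks hAs hW.block12
  rw [← schurCompl_tildeMatrix hdet] at hLL
  have hblock := norm_fromBlocks_symm_le (A.toBlocks₁₁ - L.toBlocks₁₁ * L.toBlocks₁₁ᵀ)
    (A.toBlocks₁₂ - L.toBlocks₁₁ * L.toBlocks₂₁ᵀ)
    (schurCompl (tildeMatrix A L) - L.toBlocks₂₂ * L.toBlocks₂₂ᵀ)
  rw [← hLL] at hblock
  rw [transpose_transpose] at b5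
  simp only [kappa2]
  have hκ : 0 ≤ ‖A.toBlocks₁₁⁻¹‖ * ‖A.toBlocks₁₁‖ := by positivity
  set κ := ‖A.toBlocks₁₁⁻¹‖ * ‖A.toBlocks₁₁‖
  set T := tildeMatrix A L
  obtain ⟨ε, hε'⟩ : ∃ ε, ε = n * gammaErr (n + 1) u := ⟨_, rfl⟩
  have hε0 : 0 ≤ ε := by rw [hε']; positivity
  have e1 : 3 * n * gammaErr (n + 1) u = 3 * ε := by rw [hε']; ring
  have e2 : 2 * n * gammaErr (n + 1) u = 2 * ε := by rw [hε']; ring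
  rw [e1, e2]
  rw [← hε'] at b1 b2 b3 b4 b5 hε2 ⊢
  have hCm : 0 ≤ C * m ^ 2 * u ^ 2 := by positivity
  have c2 : 3 * ε * κ * ‖A.toBlocks₂₂‖ ≤ 3 * ε * κ * ‖A‖ := by gcongr
  have c3 : ε * ‖A.toBlocks₁₁‖ ≤ ε * ‖A‖ := by gcongr
  have c4 : ε * ((‖A.toBlocks₁₁‖ + ‖A.toBlocks₂₂‖) / 2) ≤ ε * ‖A‖ := by
    gcongr
    linarith
  have t3 : ‖T.toBlocks₁₁⁻¹ - schurCompl T‖ ≤ ‖A.toBlocks₁₁⁻¹ - schurCompl A‖ +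
      ‖T.toBlocks₁₁⁻¹ - A.toBlocks₁₁⁻¹‖ + ‖schurCompl T - schurCompl A‖ := by
    have : T.toBlocks₁₁⁻¹ - schurCompl T = (A.toBlocks₁₁⁻¹ - schurCompl A) +
        (T.toBlocks₁₁⁻¹ - A.toBlocks₁₁⁻¹) - (schurCompl T - schurCompl A) := by abel
    rw [this]
    exact (norm_sub_le _ _).trans (by gcongr; exact norm_add_le _ _)
  have t4 : ‖schurCompl T - L.toBlocks₂₂ * L.toBlocks₂₂ᵀ‖ ≤ ‖T.toBlocks₁₁⁻¹ - schurCompl T‖ +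
      ‖T.toBlocks₁₁⁻¹ - L.toBlocks₂₂ * L.toBlocks₂₂ᵀ‖ := by
    have : schurCompl T - L.toBlocks₂₂ * L.toBlocks₂₂ᵀ =
        (T.toBlocks₁₁⁻¹ - L.toBlocks₂₂ * L.toBlocks₂₂ᵀ) -
          (T.toBlocks₁₁⁻¹ - schurCompl T) := by abel
    rw [this, add_comm]
    exact norm_sub_le _ _
  -- In the last bound, the (1,1) and off-diagonal blocks give `2ε‖A‖`, and the (2,2) block gives
  -- `εκ(‖A₁₁⁻¹‖ + 3‖A‖) + 2εκ‖A₁₁⁻¹‖` besides `‖A₁₁⁻¹ - S‖`.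
  refine ⟨by linarith, by linarith, by linarith, by linarith⟩
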